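/- Let $S$ and $A$ be compact metric spaces with their Borel $\sigma$-algebras (states and actions), let $p(\cdot\mid s,a)$ be a Markov transition kernel from $S\times A$ to $S$, $p_0$ a probability measure on $S$ (the law of $s_0$), $r:S\times A\to\mathbb{R}$ a measurable reward, $\gamma\in(0,1)$, $m\ge 0$ an integer, and, for $i=1,\dots,m$, $S_i\subseteq S$ a measurable set and $c_i\in\mathbb{R}$. Let $\mathcal{P}(S)$ be the set of stationary randomized policies, i.e. Markov kernels $\pi(\cdot\mid s)$ from $S$ to $A$. For $\pi\in\mathcal{P}(S)$ let $\mathbb{E}[\,\cdot\mid\pi]$ be the expectation over trajectories $(s_0,a_0,s_1,a_1,\dots)$ with $s_0\sim p_0$, $a_t\sim\pi(\cdot\mid s_t)$, $s_{t+1}\sim p(\cdot\mid s_t,a_t)$, and put $$V(\pi)=\mathbb{E}\Big[\sum_{t=0}^\infty\gamma^t r(s_t,a_t)\,\Big|\,\pi\Big],\qquad U_i(\pi)=\mathbb{E}\Big[\sum_{t=0}^\infty\gamma^t\mathbf{1}(s_t\in S_i)\,\Big|\,\pi\Big].$$ Let $$P^\star=\sup\{V(\pi):\pi\in\mathcal{P}(S),\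 U_i(\pi)\ge c_i \text{ for } i=1,\dots,m\},$$ $$d(\lambda)=\sup_{\pi\in\mathcal{P}(S)}\Big[V(\pi)+\sum_{i=1}^m\lambda_i\,(U_i(\pi)-c_i)\Big],\qquad D^\star=\inf_{\lambda\in\mathbb{R}^m_+}d(\lambda).$$ Suppose that $r$ is bounded and that Slater's condition holds, i.e. there is $\pi\in\mathcal{P}(S)$ with $U_i(\pi)>c_i$ for all $i=1,\dots,m$. Then strong duality holds: $P^\star=D^\star$, and the infimum defining $D^\star$ is attained at some $\lambda\in\mathbb{R}^m_+$. -/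

import Mathlib

open MeasureTheory ProbabilityTheory

/-- Data of a discounted safe-learning problem with `m` safety constraints on a Markov decision
process with state space `S` and action space `A`. -/
structure SafeLearningProblem (S A : Type*) [MeasurableSpace S] [MeasurableSpace A] (m : ℕ) where
  /-- The law of the initial state `s₀`. -/
  init : Measure S
  init_prob : IsProbabilityMeasure init
  /-- The transition kernel, `trans (s, a)` is the law of `s_{t+1}` given `s_t = s`, `a_t = a`. -/
  trans : Kernel (S × A) S
  trans_markov : IsMarkovKernel trans
  /-- The reward function. -/
  reward : S → A → ℝ
  reward_measurable : Measurable (Function.uncurry reward)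
  /-- The discount factor. -/
  γ : ℝ
  γ_pos : 0 < γ
  γ_lt_one : γ < 1
  /-- The safe sets. -/
  safe : Fin m → Set S
  safe_measurable : ∀ i, MeasurableSet (safe i)
  /-- The required levels in the constraints. -/
  c : Fin m → ℝ

/-- Stationary randomized policies: probability measures on `A` depending measurably on the
state. -/
def Policy (S A : Type*) [MeasurableSpace S] [MeasurableSpace A] : Type _ :=
  {π : Kernel S A // IsMarkovKernel π}

namespace SafeLearningProblem

variable {S A : Type*} [MeasurableSpace S] [MeasurableSpace A] {m : ℕ}

/-- One step of the state-action chain under the policy `π`: from `(s, a)`, the next state `s'` is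
drawn from `trans (s, a)`, then the next action is drawn from `π s'`. -/
noncomputable def stepKernel (M : SafeLearningProblem S A m) (π : Policy S A) :
    Kernel (S × A) (S × A) :=
  M.trans ⊗ₖ Kernel.prodMkLeft (S × A) π.1

instance (M : SafeLearningProblem S A m) (π : Policy S A) : IsMarkovKernel (M.stepKernel π) := by
  have := M.trans_markov
  have := π.2
  unfold stepKernel
  infer_instance

/-- The same step, as a kernel from histories up to time `n`: only the last state-action pair
matters (the Markov property). -/
noncomputable def historyKernel (M : SafeLearningProblem S A m) (π : Policy S A) (n : ℕ) :
    Kernel (Π _ : Finset.Iic n, S × A) (S × A) :=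
  (M.stepKernel π).comap (fun h => h ⟨n, Finset.mem_Iic.2 le_rfl⟩) (measurable_pi_apply _)

instance (M : SafeLearningProblem S A m) (π : Policy S A) (n : ℕ) :
    IsMarkovKernel (M.historyKernel π n) := by
  unfold historyKernel
  infer_instance

/-- The law of the trajectory `(s₀, a₀), (s₁, a₁), …` under the policy `π`, with `s₀` drawn from
`init` and `a₀` from `π s₀`. -/
noncomputable def trajLaw (M : SafeLearningProblem S A m) (π : Policy S A) :
    Measure (ℕ → S × A) :=
  Kernel.trajMeasure (X := fun _ => S × A) (M.init ⊗ₘ π.1) (M.historyKernel π)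

/-- The value `V(π)`, the expected discounted reward. -/
noncomputable def value (M : SafeLearningProblem S A m) (π : Policy S A) : ℝ :=
  ∫ τ, ∑' t : ℕ, M.γ ^ t * M.reward (τ t).1 (τ t).2 ∂(M.trajLaw π)

/-- `U_i(π)`, the expected discounted number of visits to the `i`-th safe set. -/
noncomputable def safety (M : SafeLearningProblem S A m) (i : Fin m) (π : Policy S A) : ℝ :=
  ∫ τ, ∑' t : ℕ, M.γ ^ t * (M.safe i).indicator (fun _ => (1 : ℝ)) (τ t).1 ∂(M.trajLaw π)

/-- The optimal value `P⋆` of the constrained problem (`⊥` if it is infeasible). -/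
noncomputable def primalValue (M : SafeLearningProblem S A m) : EReal :=
  ⨆ (π : Policy S A) (_ : ∀ i, M.c i ≤ M.safety i π), (M.value π : EReal)

/-- The Lagrangian. -/
noncomputable def lagrangian (M : SafeLearningProblem S A m) (π : Policy S A)
    (l : Fin m → ℝ) : ℝ :=
  M.value π + ∑ i, l i * (M.safety i π - M.c i)

/-- The dual function `d`. -/
noncomputable def dualFunction (M : SafeLearningProblem S A m) (l : Fin m → ℝ) : EReal :=
  ⨆ π : Policy S A, (M.lagrangian π l : EReal)

/-- The optimal value `D⋆` of the dual problem. -/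
noncomputable def dualValue (M : SafeLearningProblem S A m) : EReal :=
  ⨅ (l : Fin m → ℝ) (_ : ∀ i, 0 ≤ l i), M.dualFunction l

/-- Slater's condition: some policy satisfies all constraints strictly. -/
def Slater (M : SafeLearningProblem S A m) : Prop :=
  ∃ π : Policy S A, ∀ i, M.c i < M.safety i π

end SafeLearningProblem

namespace SafeLearningProblem

variable {S A : Type*} [MeasurableSpace S] [MeasurableSpace A] {m : ℕ}

/-! `value` and `safety` are not concave in the policy, but both are integrals of bounded functions
against the discounted occupancy measure, hence linear in it. For each policy the occupancy measure
is the unique finite solution of a flow equation (`occupancy_eq`, `eq_occupancy`). A mixture of two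
occupancy measures solves the flow equation of its own conditional kernel, so it is again an
occupancy measure, and the attainable vectors of objective and constraint values form a convex set.
Separation in finite dimension then gives multipliers, Slater's condition ensuring that the
hyperplane is not vertical (`exists_lagrange_multipliers`). Weak duality gives the other inequality.
-/

instance (M : SafeLearningProblem S A m) : IsProbabilityMeasure M.init := M.init_prob

instance (M : SafeLearningProblem S A m) : IsMarkovKernel M.trans := M.trans_markov

instance (π : Policy S A) : IsMarkovKernel π.1 := π.2

instance (M : SafeLearningProblem S A m) (π : Policy S A) :
    IsProbabilityMeasure (M.trajLaw π) := by
  unfold trajLaw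
  infer_instance

/-! ### Marginals of the trajectory law -/

theorem stepKernel_comp (M : SafeLearningProblem S A m) (π : Policy S A)
    (ν : Measure (S × A)) [SFinite ν] :
    M.stepKernel π ∘ₘ ν = (M.trans ∘ₘ ν) ⊗ₘ π.1 := by
  ext s hs
  rw [Measure.bind_apply hs (Kernel.aemeasurable _), Measure.compProd_apply hs,
    Measure.lintegral_bind (Kernel.aemeasurable _)
      (Kernel.measurable_kernel_prodMk_left hs).aemeasurable]
  refine lintegral_congr fun x => ?_
  rw [stepKernel, Kernel.compProd_apply hs]
  rfl

theorem trajLaw_map_zero (M : SafeLearningProblem S A m) (π : Policy S A) :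
    (M.trajLaw π).map (fun τ => τ 0) = M.init ⊗ₘ π.1 := by
  have h : (fun τ : ℕ → S × A => τ 0) =
      (fun h : (Π _ : Finset.Iic 0, S × A) => h ⟨0, Finset.mem_Iic.2 le_rfl⟩) ∘
        Preorder.frestrictLe (π := fun _ => S × A) 0 := rfl
  rw [h, ← Measure.map_map (measurable_pi_apply _) (by fun_prop), trajLaw, Kernel.trajMeasure,
    Measure.map_comp _ _ (by fun_prop), Kernel.traj_map_frestrictLe, Kernel.partialTraj_self,
    Measure.id_comp, Measure.map_map (measurable_pi_apply _) (by fun_prop)]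
  exact Measure.map_id

theorem trajLaw_map_succ (M : SafeLearningProblem S A m) (π : Policy S A) (n : ℕ) :
    (M.trajLaw π).map (fun τ => τ (n + 1)) =
      M.stepKernel π ∘ₘ (M.trajLaw π).map (fun τ => τ n) := by
  have h := Kernel.map_frestrictLe_trajMeasure_compProd_eq_map_trajMeasure
    (X := fun _ => S × A) (μ₀ := M.init ⊗ₘ π.1) (κ := M.historyKernel π) (a := n)
  have h2 := congrArg Measure.snd h
  rw [Measure.snd_compProd, Measure.snd_map_prodMk (by fun_prop)] at h2
  rw [trajLaw, ← h2]
  ext s hs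
  rw [Measure.bind_apply hs (Kernel.aemeasurable _), Measure.bind_apply hs (Kernel.aemeasurable _),
    lintegral_map (Kernel.measurable_coe _ hs) (by fun_prop),
    lintegral_map (Kernel.measurable_coe _ hs) (by fun_prop)]
  rfl

/-! ### Occupancy measures and their flow equation -/

/-- The discounted occupancy measure of state-action pairs under the policy `π`. -/
noncomputable def occupancy (M : SafeLearningProblem S A m) (π : Policy S A) : Measure (S × A) :=
  Measure.sum fun t : ℕ => ENNReal.ofReal (M.γ ^ t) • (M.trajLaw π).map (fun τ => τ t)

theorem tsum_ofReal_pow_lt_top (M : SafeLearningProblem S A m) :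
    ∑' t : ℕ, ENNReal.ofReal (M.γ ^ t) < ⊤ := by
  rw [← ENNReal.ofReal_tsum_of_nonneg (fun t => pow_nonneg M.γ_pos.le t)
    (summable_geometric_of_lt_one M.γ_pos.le M.γ_lt_one)]
  exact ENNReal.ofReal_lt_top

instance (M : SafeLearningProblem S A m) (π : Policy S A) (t : ℕ) :
    IsProbabilityMeasure ((M.trajLaw π).map (fun τ => τ t)) :=
  Measure.isProbabilityMeasure_map (measurable_pi_apply t).aemeasurable

instance (M : SafeLearningProblem S A m) (π : Policy S A) : IsFiniteMeasure (M.occupancy π) := by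
  refine ⟨?_⟩
  rw [occupancy, Measure.sum_apply _ MeasurableSet.univ]
  simpa using M.tsum_ofReal_pow_lt_top

theorem integral_tsum_discounted (M : SafeLearningProblem S A m) (π : Policy S A)
    {f : S × A → ℝ} (hf : Measurable f) {B : ℝ} (hB : ∀ x, |f x| ≤ B) :
    ∫ τ, ∑' t : ℕ, M.γ ^ t * f (τ t) ∂(M.trajLaw π) = ∫ x, f x ∂(M.occupancy π) := by
  have hint : Integrable f (M.occupancy π) :=
    Integrable.of_bound hf.aestronglyMeasurable B (ae_of_all _ hB)
  have hγ (t : ℕ) : 0 ≤ M.γ ^ t := pow_nonneg M.γ_pos.le t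
  have hB0 (τ : ℕ → S × A) : 0 ≤ B := (abs_nonneg _).trans (hB (τ 0))
  have hm (t : ℕ) : Measurable fun τ : ℕ → S × A => M.γ ^ t * f (τ t) := by fun_prop
  have hb (t : ℕ) (τ : ℕ → S × A) : ‖M.γ ^ t * f (τ t)‖ ≤ M.γ ^ t * B := by
    rw [norm_mul, Real.norm_of_nonneg (hγ t)]
    exact mul_le_mul_of_nonneg_left (hB _) (hγ t)
  have hi (t : ℕ) : Integrable (fun τ : ℕ → S × A => M.γ ^ t * f (τ t)) (M.trajLaw π) :=
    Integrable.of_bound (hm t).aestronglyMeasurable _ (ae_of_all _ (hb t))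
  rw [occupancy] at hint ⊢
  rw [integral_sum_measure hint, ← integral_tsum_of_summable_integral_norm hi]
  · refine tsum_congr fun t => ?_
    rw [integral_smul_measure, ENNReal.toReal_ofReal (hγ t),
      integral_map (measurable_pi_apply t).aemeasurable hf.aestronglyMeasurable,
      integral_const_mul, smul_eq_mul]
  · refine Summable.of_nonneg_of_le (fun t => integral_nonneg fun _ => norm_nonneg _) (fun t => ?_)
      ((summable_geometric_of_lt_one M.γ_pos.le M.γ_lt_one).mul_right B)
    refine (integral_mono (hi t).norm (integrable_const (M.γ ^ t * B)) (hb t)).trans ?_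
    simp

theorem value_eq_integral_occupancy (M : SafeLearningProblem S A m) {B : ℝ}
    (hB : ∀ s a, |M.reward s a| ≤ B) (π : Policy S A) :
    M.value π = ∫ x, M.reward x.1 x.2 ∂(M.occupancy π) :=
  M.integral_tsum_discounted π M.reward_measurable (fun x => hB x.1 x.2)

theorem safety_eq_integral_occupancy (M : SafeLearningProblem S A m) (i : Fin m)
    (π : Policy S A) :
    M.safety i π = ∫ x, (M.safe i).indicator (fun _ => (1 : ℝ)) x.1 ∂(M.occupancy π) := by
  refine M.integral_tsum_discounted π (f := fun x => (M.safe i).indicator (fun _ => (1 : ℝ)) x.1)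
    ((measurable_const.indicator (M.safe_measurable i)).comp measurable_fst) (B := 1) fun x => ?_
  by_cases h : x.1 ∈ M.safe i <;> simp [h]

/-- Split off the term `t = 0`; the remaining terms are the same series moved one step and
discounted once. -/
theorem occupancy_eq (M : SafeLearningProblem S A m) (π : Policy S A) :
    M.occupancy π =
      M.init ⊗ₘ π.1 + ENNReal.ofReal M.γ • (M.stepKernel π ∘ₘ M.occupancy π) := by
  ext s hs
  rw [Measure.add_apply, Measure.smul_apply, Measure.bind_apply hs (Kernel.aemeasurable _)]
  simp only [occupancy, lintegral_sum_measure]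
  rw [Measure.sum_apply _ hs, tsum_eq_zero_add' ENNReal.summable, smul_eq_mul,
    ← ENNReal.tsum_mul_left]
  congr 1
  · simp [trajLaw_map_zero]
  · refine tsum_congr fun t => ?_
    rw [trajLaw_map_succ, lintegral_smul_measure, Measure.smul_apply,
      Measure.bind_apply hs (Kernel.aemeasurable _), smul_eq_mul, smul_eq_mul, ← mul_assoc,
      ← ENNReal.ofReal_mul M.γ_pos.le, pow_succ']

/-- Iterating the equation `n` times produces the first `n` terms of the occupancy series and a
remainder of mass `γ ^ n * ν univ`, which tends to `0` as `ν` is finite. -/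
theorem eq_occupancy (M : SafeLearningProblem S A m) (π : Policy S A) (ν : Measure (S × A))
    [IsFiniteMeasure ν]
    (hν : ν = M.init ⊗ₘ π.1 + ENNReal.ofReal M.γ • (M.stepKernel π ∘ₘ ν)) :
    ν = M.occupancy π := by
  -- `R` is `ν` pushed `n` steps along the chain. It solves the flow equation started from the
  -- time-`n` marginal, which is what drives the induction.
  have expand (n : ℕ) : ∃ R : Measure (S × A), R Set.univ = ν Set.univ ∧
      R = (M.trajLaw π).map (fun τ => τ n) + ENNReal.ofReal M.γ • (M.stepKernel π ∘ₘ R) ∧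
      ∀ s, ν s = ∑ t ∈ Finset.range n,
        ENNReal.ofReal (M.γ ^ t) * (M.trajLaw π).map (fun τ => τ t) s +
          ENNReal.ofReal (M.γ ^ n) * R s := by
    induction n with
    | zero => exact ⟨ν, rfl, by rw [trajLaw_map_zero]; exact hν, by simp⟩
    | succ n ih =>
      obtain ⟨R, h1, h2, h3⟩ := ih
      refine ⟨M.stepKernel π ∘ₘ R, ?_, ?_, fun s => ?_⟩
      · rw [Measure.bind_apply MeasurableSet.univ (Kernel.aemeasurable _)]
        simpa using h1
      · conv_lhs => rw [h2]
        rw [Measure.comp_add, Measure.comp_smul, ← trajLaw_map_succ]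
      · rw [h3 s, Finset.sum_range_succ, add_assoc]
        congr 1
        conv_lhs => rw [h2]
        rw [Measure.add_apply, Measure.smul_apply, mul_add, smul_eq_mul, ← mul_assoc,
          ← ENNReal.ofReal_mul (pow_nonneg M.γ_pos.le n), ← pow_succ]
  ext s hs
  have hlim : Filter.Tendsto (fun n => ∑ t ∈ Finset.range n,
      ENNReal.ofReal (M.γ ^ t) * (M.trajLaw π).map (fun τ => τ t) s +
        ENNReal.ofReal (M.γ ^ n) * (expand n).choose s) Filter.atTop
      (nhds (M.occupancy π s + 0)) := by
    refine Filter.Tendsto.add ?_ ?_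
    · rw [occupancy, Measure.sum_apply _ hs]
      exact ENNReal.tendsto_nat_tsum _
    · have hz : Filter.Tendsto (fun n : ℕ => ENNReal.ofReal (M.γ ^ n) * ν Set.univ) Filter.atTop
          (nhds 0) := by
        have h0 : Filter.Tendsto (fun n : ℕ => ENNReal.ofReal (M.γ ^ n)) Filter.atTop (nhds 0) := by
          simpa using ENNReal.tendsto_ofReal
            (tendsto_pow_atTop_nhds_zero_of_lt_one M.γ_pos.le M.γ_lt_one)
        simpa using ENNReal.Tendsto.mul_const h0 (Or.inr (measure_ne_top ν Set.univ))
      refine tendsto_of_tendsto_of_tendsto_of_le_of_le tendsto_const_nhds hz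
        (fun _ => zero_le) fun n => ?_
      refine mul_le_mul_right ((measure_mono (Set.subset_univ s)).trans_eq ?_) _
      exact (expand n).choose_spec.1
  rw [add_zero] at hlim
  exact tendsto_nhds_unique
    (tendsto_const_nhds.congr fun n => (expand n).choose_spec.2.2 s) hlim

/-- Occupancy measures are closed under convex combinations: disintegrating the mixture of two
occupancy measures over its state marginal yields a policy that realizes it. -/
theorem exists_occupancy_eq_convex_combination [StandardBorelSpace A]
    (M : SafeLearningProblem S A m) (π₁ π₂ : Policy S A) {a b : ℝ} (ha : 0 ≤ a) (hb : 0 ≤ b)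
    (hab : a + b = 1) :
    ∃ π : Policy S A, M.occupancy π =
      ENNReal.ofReal a • M.occupancy π₁ + ENNReal.ofReal b • M.occupancy π₂ := by
  have : Nonempty (S × A) := (M.init ⊗ₘ π₁.1).nonempty_of_neZero
  have : Nonempty A := ⟨(Classical.arbitrary (S × A)).2⟩
  set ν := ENNReal.ofReal a • M.occupancy π₁ + ENNReal.ofReal b • M.occupancy π₂ with hν
  have hfin : IsFiniteMeasure ν := by
    have := Measure.smul_finite (M.occupancy π₁) (ENNReal.ofReal_ne_top (r := a))
    have := Measure.smul_finite (M.occupancy π₂) (ENNReal.ofReal_ne_top (r := b))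
    infer_instance
  -- On state marginals the policy enters only through its occupancy measure, so this identity is
  -- affine and passes to mixtures.
  have hfst (π : Policy S A) : (M.occupancy π).fst =
      M.init + ENNReal.ofReal M.γ • (M.trans ∘ₘ M.occupancy π) := by
    conv_lhs => rw [occupancy_eq, stepKernel_comp]
    rw [← Measure.compProd_smul_left, ← Measure.compProd_add_left, Measure.fst_compProd]
  have hab' : ENNReal.ofReal a + ENNReal.ofReal b = 1 := by
    rw [← ENNReal.ofReal_add ha hb, hab, ENNReal.ofReal_one]
  have hνfst : ν.fst = M.init + ENNReal.ofReal M.γ • (M.trans ∘ₘ ν) := by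
    have h1 : ν.fst = ENNReal.ofReal a • (M.occupancy π₁).fst +
        ENNReal.ofReal b • (M.occupancy π₂).fst := by
      simp only [Measure.fst, hν, Measure.map_add _ _ measurable_fst, Measure.map_smul]
    rw [h1, hfst, hfst, hν, Measure.comp_add, Measure.comp_smul, Measure.comp_smul]
    calc _ = (ENNReal.ofReal a + ENNReal.ofReal b) • M.init + _ := by
          rw [add_smul, smul_add, smul_add, smul_comm (ENNReal.ofReal a) (ENNReal.ofReal M.γ),
            smul_comm (ENNReal.ofReal b) (ENNReal.ofReal M.γ), add_add_add_comm, ← smul_add]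
      _ = _ := by rw [hab', one_smul]
  obtain ⟨π, hπ⟩ : ∃ π : Policy S A, π.1 = ν.condKernel := ⟨⟨ν.condKernel, inferInstance⟩, rfl⟩
  refine ⟨π, (M.eq_occupancy π ν ?_).symm⟩
  rw [stepKernel_comp, ← Measure.compProd_smul_left, ← Measure.compProd_add_left, ← hνfst, hπ]
  exact (ν.disintegrate ν.condKernel).symm

end SafeLearningProblem


/-! ### Multipliers by separation -/

/-- Lagrange multipliers for a concave-like maximization problem: if the pairs of objective and
constraint values of the points of `X` form a convex set and some point satisfies all constraints
strictly, then an upper bound `p` for the objective on the feasible points bounds some Lagrangian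
with nonnegative multipliers. -/
theorem exists_lagrange_multipliers {X ι : Type*} [Fintype ι] (V : X → ℝ) (G : X → ι → ℝ)
    (hconv : ∀ x y : X, ∀ a b : ℝ, 0 ≤ a → 0 ≤ b → a + b = 1 →
      ∃ z, V z = a * V x + b * V y ∧ ∀ i, G z i = a * G x i + b * G y i)
    (hslater : ∃ x, ∀ i, 0 < G x i) {p : ℝ} (hp : ∀ x, (∀ i, 0 ≤ G x i) → V x ≤ p) :
    ∃ l : ι → ℝ, (∀ i, 0 ≤ l i) ∧ ∀ x, V x + ∑ i, l i * G x i ≤ p := by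
  classical
  -- Strict inequalities make `E` open, so separating a point from it needs no closedness or
  -- attainment.
  let E : Set (ℝ × (ι → ℝ)) := {q | ∃ x, q.1 < V x ∧ ∀ i, q.2 i < G x i}
  have hEc : Convex ℝ E := by
    rintro q ⟨x, hx1, hx2⟩ r ⟨y, hy1, hy2⟩ a b ha hb hab
    obtain ⟨z, hz1, hz2⟩ := hconv x y a b ha hb hab
    have key {s t u w : ℝ} (h1 : s < u) (h2 : t < w) : a * s + b * t < a * u + b * w := by
      rcases ha.eq_or_lt with rfl | ha
      · have : b = 1 := by linarith
        subst this; linarith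
      · exact add_lt_add_of_lt_of_le (mul_lt_mul_of_pos_left h1 ha)
          (mul_le_mul_of_nonneg_left h2.le hb)
    refine ⟨z, ?_, fun i => ?_⟩
    · rw [hz1]; exact key hx1 hy1
    · rw [hz2]; exact key (hx2 i) (hy2 i)
  have hEo : IsOpen E := by
    have : E = ⋃ x, ({q : ℝ × (ι → ℝ) | q.1 < V x} ∩ ⋂ i, {q | q.2 i < G x i}) := by
      ext q; simp [E]
    rw [this]
    refine isOpen_iUnion fun x => IsOpen.inter (isOpen_lt (by fun_prop) (by fun_prop))
      (isOpen_iInter_of_finite fun i => isOpen_lt (by fun_prop) (by fun_prop))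
  have hE0 : (p, (0 : ι → ℝ)) ∉ E := by
    rintro ⟨x, hx1, hx2⟩
    exact absurd (hp x fun i => (hx2 i).le) (not_le.2 hx1)
  obtain ⟨f, hf⟩ := geometric_hahn_banach_open_point hEc hEo hE0
  set α := f (1, 0) with hα
  set β : ι → ℝ := fun i => f (0, Pi.single i 1) with hβ
  have hfe (v : ℝ) (u : ι → ℝ) : f (v, u) = v * α + ∑ i, u i * β i := by
    have h1 : (v, u) = v • ((1 : ℝ), (0 : ι → ℝ)) +
        ∑ i, u i • ((0 : ℝ), (Pi.single i (1 : ℝ) : ι → ℝ)) := by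
      ext j
      · simp [Prod.fst_sum]
      · simp [Prod.snd_sum, Finset.sum_apply, Pi.single_apply]
    simp only [h1, map_add, map_sum, map_smul, smul_eq_mul, hα, hβ]
  have hf' (x : X) (v : ℝ) (u : ι → ℝ) (hv : v < V x) (hu : ∀ i, u i < G x i) :
      v * α + ∑ i, u i * β i < p * α := by
    have := hf (v, u) ⟨x, hv, hu⟩
    simpa [hfe] using this
  -- passing to the closure
  have hf0 (x : X) (v : ℝ) (u : ι → ℝ) (hv : v ≤ V x) (hu : ∀ i, u i ≤ G x i) :
      v * α + ∑ i, u i * β i ≤ p * α := by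
    have ht : Filter.Tendsto (fun ε : ℝ => (v - ε) * α + ∑ i, (u i - ε) * β i)
        (nhdsWithin 0 (Set.Ioi 0)) (nhds ((v - 0) * α + ∑ i, (u i - 0) * β i)) :=
      Filter.Tendsto.mono_left (Continuous.tendsto (by fun_prop) 0) nhdsWithin_le_nhds
    simp only [sub_zero] at ht
    refine le_of_tendsto ht (Filter.eventually_of_mem self_mem_nhdsWithin fun ε hε => ?_)
    have hε : 0 < ε := hε
    exact (hf' x _ (fun i => u i - ε) (by linarith) (fun i => by linarith [hu i])).le
  obtain ⟨x₀, hx₀⟩ := hslater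
  -- `E` is closed downwards: lowering one coordinate without bound forces its coefficient to be
  -- nonnegative.
  have nonneg_of_bdd {s C : ℝ} (h : ∀ n : ℕ, C - n * s ≤ p * α) : 0 ≤ s := by
    by_contra! hs
    obtain ⟨n, hn⟩ := exists_nat_gt ((p * α - C) / (-s))
    rw [div_lt_iff₀ (by linarith)] at hn
    linarith [h n]
  have hα0 : 0 ≤ α := by
    refine nonneg_of_bdd (C := V x₀ * α + ∑ i, G x₀ i * β i) fun n => ?_
    have := hf0 x₀ (V x₀ - n) (G x₀) (by linarith [n.cast_nonneg (α := ℝ)]) (fun i => le_rfl)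
    linarith
  have hβ0 (j : ι) : 0 ≤ β j := by
    refine nonneg_of_bdd (C := V x₀ * α + ∑ i, G x₀ i * β i) fun n => ?_
    have := hf0 x₀ (V x₀) (fun i => G x₀ i - if i = j then (n : ℝ) else 0) le_rfl (fun i => by
      split_ifs <;> simp)
    simp only [sub_mul, Finset.sum_sub_distrib, ite_mul, zero_mul, Finset.sum_ite_eq',
      Finset.mem_univ, if_true] at this
    linarith
  -- If `α = 0`, Slater's point puts `(V x₀ - 1, 0)` in `E`, and strict separation reads `0 < 0`.
  have hαpos : 0 < α := by
    refine hα0.lt_of_ne fun h => ?_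
    have := hf' x₀ (V x₀ - 1) 0 (by linarith) hx₀
    simp [← h] at this
  refine ⟨fun i => β i / α, fun i => div_nonneg (hβ0 i) hα0, fun x => ?_⟩
  have := hf0 x (V x) (G x) le_rfl (fun i => le_rfl)
  refine le_of_mul_le_mul_right ?_ hαpos
  rw [add_mul, Finset.sum_mul]
  refine le_trans (le_of_eq ?_) this
  congr 1
  refine Finset.sum_congr rfl fun i _ => ?_
  field_simp

namespace SafeLearningProblem

variable {S A : Type*} [MeasurableSpace S] [MeasurableSpace A] {m : ℕ}

/-! ### Strong duality -/

theorem integral_occupancy_convex_combination (M : SafeLearningProblem S A m)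
    {π π₁ π₂ : Policy S A} {a b : ℝ} (ha : 0 ≤ a) (hb : 0 ≤ b)
    (h : M.occupancy π = ENNReal.ofReal a • M.occupancy π₁ + ENNReal.ofReal b • M.occupancy π₂)
    {f : S × A → ℝ} (hf : Measurable f) {B : ℝ} (hB : ∀ x, |f x| ≤ B) :
    ∫ x, f x ∂(M.occupancy π) =
      a * ∫ x, f x ∂(M.occupancy π₁) + b * ∫ x, f x ∂(M.occupancy π₂) := by
  have hi (π : Policy S A) : Integrable f (M.occupancy π) :=
    Integrable.of_bound hf.aestronglyMeasurable B (ae_of_all _ hB)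
  rw [h, integral_add_measure ((hi π₁).smul_measure ENNReal.ofReal_ne_top)
    ((hi π₂).smul_measure ENNReal.ofReal_ne_top), integral_smul_measure, integral_smul_measure,
    ENNReal.toReal_ofReal ha, ENNReal.toReal_ofReal hb, smul_eq_mul, smul_eq_mul]

theorem exists_value_safety_convex_combination [StandardBorelSpace A]
    (M : SafeLearningProblem S A m) {B : ℝ} (hB : ∀ s a, |M.reward s a| ≤ B)
    (π₁ π₂ : Policy S A) {a b : ℝ} (ha : 0 ≤ a) (hb : 0 ≤ b) (hab : a + b = 1) :
    ∃ π : Policy S A, M.value π = a * M.value π₁ + b * M.value π₂ ∧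
      ∀ i, M.safety i π = a * M.safety i π₁ + b * M.safety i π₂ := by
  obtain ⟨π, hπ⟩ := M.exists_occupancy_eq_convex_combination π₁ π₂ ha hb hab
  refine ⟨π, ?_, fun i => ?_⟩
  · simp only [M.value_eq_integral_occupancy hB]
    exact M.integral_occupancy_convex_combination ha hb hπ M.reward_measurable
      fun x => hB x.1 x.2
  · simp only [safety_eq_integral_occupancy]
    refine M.integral_occupancy_convex_combination ha hb hπ
      ((measurable_const.indicator (M.safe_measurable i)).comp measurable_fst) (B := 1) fun x => ?_
    by_cases h : x.1 ∈ M.safe i <;> simp [h]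

theorem occupancy_univ (M : SafeLearningProblem S A m) (π : Policy S A) :
    M.occupancy π Set.univ = ∑' t : ℕ, ENNReal.ofReal (M.γ ^ t) := by
  rw [occupancy, Measure.sum_apply _ MeasurableSet.univ]
  simp

theorem value_le (M : SafeLearningProblem S A m) {B : ℝ} (hB : ∀ s a, |M.reward s a| ≤ B)
    (π : Policy S A) : M.value π ≤ B * (∑' t : ℕ, ENNReal.ofReal (M.γ ^ t)).toReal := by
  rw [M.value_eq_integral_occupancy hB, ← M.occupancy_univ π]
  have h : ∀ᵐ x ∂(M.occupancy π), ‖M.reward x.1 x.2‖ ≤ B := ae_of_all _ fun x => hB x.1 x.2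
  exact (le_abs_self _).trans (norm_integral_le_of_norm_le_const h)

theorem primalValue_le_dualFunction (M : SafeLearningProblem S A m) {l : Fin m → ℝ}
    (hl : ∀ i, 0 ≤ l i) : M.primalValue ≤ M.dualFunction l := by
  refine iSup₂_le fun π hπ => le_trans (EReal.coe_le_coe_iff.2 ?_)
    (le_iSup (fun π : Policy S A => (M.lagrangian π l : EReal)) π)
  exact le_add_of_nonneg_right
    (Finset.sum_nonneg fun i _ => mul_nonneg (hl i) (sub_nonneg.2 (hπ i)))

theorem exists_dualFunction_le_primalValue [StandardBorelSpace A]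
    (M : SafeLearningProblem S A m) (hr : ∃ B : ℝ, ∀ s a, |M.reward s a| ≤ B)
    (hS : M.Slater) :
    ∃ l : Fin m → ℝ, (∀ i, 0 ≤ l i) ∧ M.dualFunction l ≤ M.primalValue := by
  obtain ⟨B, hB⟩ := hr
  obtain ⟨π₀, hπ₀⟩ := hS
  have hlow (π : Policy S A) (hπ : ∀ i, M.c i ≤ M.safety i π) :
      (M.value π : EReal) ≤ M.primalValue :=
    le_iSup₂ (f := fun (π : Policy S A) (_ : ∀ i, M.c i ≤ M.safety i π) => (M.value π : EReal))
      π hπ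
  -- Feasibility and bounded rewards make the primal value finite, so its `toReal` can serve as the
  -- bound `p`.
  have hbot : M.primalValue ≠ ⊥ :=
    ne_bot_of_le_ne_bot (EReal.coe_ne_bot _) (hlow π₀ fun i => (hπ₀ i).le)
  have htop : M.primalValue ≠ ⊤ :=
    ne_top_of_le_ne_top (EReal.coe_ne_top _)
      (iSup₂_le fun π _ => EReal.coe_le_coe_iff.2 (M.value_le hB π))
  obtain ⟨l, hl, h⟩ := exists_lagrange_multipliers M.value (fun π i => M.safety i π - M.c i)
    (p := M.primalValue.toReal) (fun π₁ π₂ a b ha hb hab => by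
      obtain ⟨π, h1, h2⟩ := M.exists_value_safety_convex_combination hB π₁ π₂ ha hb hab
      refine ⟨π, h1, fun i => ?_⟩
      rw [h2]
      linear_combination (-M.c i) * (-hab))
    ⟨π₀, fun i => sub_pos.2 (hπ₀ i)⟩ (fun π hπ => by
      rw [← EReal.coe_le_coe_iff, EReal.coe_toReal htop hbot]
      exact hlow π fun i => sub_nonneg.1 (hπ i))
  refine ⟨l, hl, iSup_le fun π => ?_⟩
  rw [← EReal.coe_toReal htop hbot, EReal.coe_le_coe_iff]
  exact h π

end SafeLearningProblem

theorem theorem3 {S A : Type*}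
    [MetricSpace S] [CompactSpace S] [MeasurableSpace S] [BorelSpace S]
    [MetricSpace A] [CompactSpace A] [MeasurableSpace A] [BorelSpace A]
    {m : ℕ} (M : SafeLearningProblem S A m)
    (hr : ∃ B : ℝ, ∀ s a, |M.reward s a| ≤ B)
    (hS : M.Slater) :
    M.primalValue = M.dualValue ∧
      ∃ l : Fin m → ℝ, (∀ i, 0 ≤ l i) ∧ M.dualFunction l = M.dualValue := by
  -- A compact metric `A` is Polish, hence standard Borel, as the disintegration requires.
  obtain ⟨l, hl, h⟩ := M.exists_dualFunction_le_primalValue hr hS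
  have hPD : M.primalValue ≤ M.dualValue := le_iInf₂ fun _ => M.primalValue_le_dualFunction
  have hDl : M.dualValue ≤ M.dualFunction l :=
    iInf₂_le (f := fun (l : Fin m → ℝ) (_ : ∀ i, 0 ≤ l i) => M.dualFunction l) l hl
  exact ⟨hPD.antisymm (hDl.trans h), l, hl, (h.trans hPD).antisymm hDl⟩
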